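/- Let $m \ge 2$ be an integer, and for $n \ge 0$ let $N = m^n$. Let $\tau_m = (1\ 2\ \cdots\ m) \in S_m$ be the standard $m$-cycle and let $$B_{s,n}^{(m)} = \bigotimes_{j=1}^n \langle \tau_m\rangle \subset S_N$$ be the group of simple $m$-nary butterfly permutations, i.e. the set of all $\sigma_1 \otimes \cdots \otimes \sigma_n$ with $\sigma_j \in \langle\tau_m\rangle$, where the Kronecker product $\sigma\otimes\tau \in S_{ab}$ of $\sigma \in S_a$, $\tau \in S_b$ is the permutation whose permutation matrix is the Kronecker product $P_\sigma \otimes P_\tau$ (for $n=0$ it is the trivial group $S_1$). For a permutation $\sigma \in S_N$ let $L(\sigma)$ be the length of a longest increasing subsequence: the largest $k$ for which there are indices $i_1 < \cdots < i_k$ with $\sigma(i_1) < \cdots < \sigma(i_k)$. For $X$ uniform on $[m] = \{1,\dots,m\}$ put $$\mu_m = \mathbb{E}\log_m \max(X, m-X), \qquad \nu_m = \operatorname{Var} \log_m \max(X, m-X), \qquad \alpha_m = \log_m \mathbb{E}\max(X,m-X).$$ Let $\sigma_n$ be uniformly distributed on $B_{s,n}^{(m)}$ for each $n$. Then: 1.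 For every $n$, $L(\sigma_n)$ has the same distribution as $\prod_{j=1}^n \max(X_j, m-X_j)$, where $X_1,\dots,X_n$ are i.i.d. uniform on $[m]$. 2. For every $n$, $L(\sigma_n)$ is integrable and $\mathbb{E}\, L(\sigma_n) = N^{\alpha_m}$. 3. As $n \to \infty$, $(\log_m L(\sigma_n) - \mu_m n)/\sqrt{\nu_m n}$ converges in distribution to a standard normal random variable $Z \sim N(0,1)$. 4. If $m = 2$, then for every $n$, $\log_2 L(\sigma_n) \sim \operatorname{Binom}(n, \tfrac12)$, and $(\log_2 L(\sigma_n) - n/2)\cdot 2 n^{-1/2}$ converges in distribution to $Z \sim N(0,1)$ as $n\to\infty$. -/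

import Mathlib

open MeasureTheory ProbabilityTheory Filter

namespace Butterfly

/-- The Kronecker product `σ ⊗ τ` of two permutations, as a permutation of `[a * b]` (modelled by
`Fin (a * b)`, with `k : Fin N` standing for `k + 1 ∈ [N]`): the position `i * b + j`
(block `i`, place `j` in the block) is sent to `σ i * b + τ j`. Its permutation matrix is the
Kronecker product of the two permutation matrices. -/
def kron {a b : ℕ} (σ : Equiv.Perm (Fin a)) (τ : Equiv.Perm (Fin b)) :
    Equiv.Perm (Fin (a * b)) :=
  finProdFinEquiv.permCongr (Equiv.prodCongr σ τ)

/-- The Kronecker product as a group homomorphism (mixed-product property). -/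
def kronHom (a b : ℕ) :
    Equiv.Perm (Fin a) × Equiv.Perm (Fin b) →* Equiv.Perm (Fin (a * b)) where
  toFun p := kron p.1 p.2
  map_one' := by ext x; simp [kron, Nat.mod_add_div]
  map_mul' p q := by ext x; simp [kron]

/-- The simple `m`-nary butterfly permutations: the `n`-fold Kronecker power
`⟨τ_m⟩ ⊗ ⋯ ⊗ ⟨τ_m⟩` in the symmetric group on `m ^ n` points, where `τ_m = (1 2 ⋯ m)` is the
standard `m`-cycle `finRotate m`. -/
def simpleButterfly (m : ℕ) : (n : ℕ) → Subgroup (Equiv.Perm (Fin (m ^ n)))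
  | 0 => ⊥
  | n + 1 =>
    (((Subgroup.zpowers (finRotate m)).prod (simpleButterfly m n)).map
      (kronHom m (m ^ n))).map
        (Equiv.permCongrHom (finCongr (pow_succ' m n).symm)).toMonoidHom

/-- The length of a longest increasing subsequence of `σ`: the largest size of a set of indices
on which `σ` is strictly increasing. -/
noncomputable def lis {N : ℕ} (σ : Equiv.Perm (Fin N)) : ℕ := by
  classical
  exact (Finset.univ.filter fun s : Finset (Fin N) => StrictMonoOn σ (s : Set (Fin N))).sup
    Finset.card

/-- Finite symmetric groups carry the discrete σ-algebra. -/
instance instMeasurableSpacePermFin (N : ℕ) : MeasurableSpace (Equiv.Perm (Fin N)) := ⊤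

/-- The uniform distribution on the simple `m`-nary butterfly permutations of length `m ^ n`. -/
noncomputable def unifSimpleButterfly (m n : ℕ) : Measure (Equiv.Perm (Fin (m ^ n))) :=
  uniformOn (simpleButterfly m n : Set (Equiv.Perm (Fin (m ^ n))))

/-- The uniform distribution on `[m] = {1, …, m}`. -/
noncomputable def unifIcc (m : ℕ) : Measure ℕ := uniformOn (Set.Icc 1 m)

/-- `μ_m = E log_m max(X, m - X)` for `X` uniform on `[m]`. -/
noncomputable def muConst (m : ℕ) : ℝ :=
  ∫ x, Real.logb m ((max x (m - x) : ℕ) : ℝ) ∂(unifIcc m)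

/-- `ν_m = Var log_m max(X, m - X)` for `X` uniform on `[m]`. -/
noncomputable def nuConst (m : ℕ) : ℝ :=
  variance (fun x : ℕ => Real.logb m ((max x (m - x) : ℕ) : ℝ)) (unifIcc m)

/-- The exponent `α_m` with `m ^ α_m = E max(X, m - X)` for `X` uniform on `[m]`. -/
noncomputable def alphaConst (m : ℕ) : ℝ :=
  Real.logb m (∫ x, ((max x (m - x) : ℕ) : ℝ) ∂(unifIcc m))

end Butterfly

/-! The pair order on `Fin a × Fin b` is lexicographic, so an increasing set for σ ⊗ τ meets blocks
whose indices are increasing for σ, and inside each block it is increasing for τ. This makes `lis`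
multiplicative (`lis_kron`). A power τ_m ^ k with 1 ≤ k ≤ m has two increasing runs, of lengths m -
k and k, and all values of the first exceed all values of the second. An increasing subsequence
stays in one run, so the optimum is max(k, m - k) (`lis_finRotate_pow`).

Exponent vectors in [m]^n parametrize the group bijectively, so a uniform permutation amounts to
i.i.d. uniform exponents, and L is a product of n independent factors max(X, m - X)
(`identDistrib_lis`).

The mean of such a product is the product of the means. Its logarithm is an i.i.d. sum with positive
variance (`nuConst_pos`), to which the central limit theorem applies. For m = 2 each factor is 1 or
2 with equal probability, so log_2 L counts heads in n fair tosses. -/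

namespace Butterfly

/-! ### Longest increasing subsequences: basic bounds -/

section Lis

variable {N : ℕ} {σ : Equiv.Perm (Fin N)}

lemma card_le_lis {s : Finset (Fin N)} (hs : StrictMonoOn σ (s : Set (Fin N))) :
    s.card ≤ lis σ := by
  classical
  unfold lis
  exact Finset.le_sup (f := Finset.card) (by simpa using hs)

lemma lis_le {k : ℕ}
    (h : ∀ s : Finset (Fin N), StrictMonoOn σ (s : Set (Fin N)) → s.card ≤ k) : lis σ ≤ k := by
  classical
  unfold lis
  exact Finset.sup_le fun s hs => h s (by simpa using hs)

lemma exists_card_eq_lis (σ : Equiv.Perm (Fin N)) :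
    ∃ s : Finset (Fin N), StrictMonoOn σ (s : Set (Fin N)) ∧ s.card = lis σ := by
  classical
  obtain ⟨s, hs, h⟩ := Finset.exists_mem_eq_sup
    (Finset.univ.filter fun s : Finset (Fin N) => StrictMonoOn σ (s : Set (Fin N)))
    ⟨∅, by simp [StrictMonoOn]⟩ Finset.card
  refine ⟨s, by simpa using hs, ?_⟩
  unfold lis
  exact h.symm

lemma lis_permCongr_finCongr {a b : ℕ} (h : a = b) (σ : Equiv.Perm (Fin a)) :
    lis ((finCongr h).permCongr σ) = lis σ := by
  subst h
  rfl

lemma lis_of_fin_one (σ : Equiv.Perm (Fin 1)) : lis σ = 1 := by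
  refine le_antisymm (lis_le fun s _ => (Finset.card_le_univ s).trans (by simp)) ?_
  simpa using card_le_lis (σ := σ) (s := Finset.univ)
    (fun a _ b _ hab => absurd hab (by simp [Subsingleton.elim a b]))

end Lis

/-! ### Kronecker products and the lexicographic order -/

section Kron

variable {a b : ℕ}

lemma kron_finProdFinEquiv (σ : Equiv.Perm (Fin a)) (τ : Equiv.Perm (Fin b)) (p : Fin a × Fin b) :
    kron σ τ (finProdFinEquiv p) = finProdFinEquiv (σ p.1, τ p.2) := by
  simp [kron, Equiv.permCongr_apply, Prod.map_apply']

lemma finProdFinEquiv_lt_iff (p q : Fin a × Fin b) :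
    finProdFinEquiv p < finProdFinEquiv q ↔ p.1 < q.1 ∨ p.1 = q.1 ∧ p.2 < q.2 := by
  obtain ⟨i, j⟩ := p
  obtain ⟨i', j'⟩ := q
  have key : ∀ (u v x y : ℕ), x < b → y < b → u < v → x + b * u < y + b * v := by
    intro u v x y hx hy h
    have : b * (u + 1) ≤ b * v := Nat.mul_le_mul_left b h
    nlinarith
  rw [Fin.lt_def]
  simp only [finProdFinEquiv_apply_val, Fin.lt_def, Fin.ext_iff]
  rcases lt_trichotomy (i : ℕ) i' with h | h | h
  · simp [h, key _ _ _ _ j.2 j'.2 h]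
  · simp [h]
  · have := key _ _ _ _ j'.2 j.2 h
    omega

/-- The length of a longest increasing subsequence is multiplicative for Kronecker products. -/
lemma lis_kron (σ : Equiv.Perm (Fin a)) (τ : Equiv.Perm (Fin b)) :
    lis (kron σ τ) = lis σ * lis τ := by
  classical
  refine le_antisymm (lis_le fun s hs => ?_) ?_
  · set t : Finset (Fin a × Fin b) := s.map finProdFinEquiv.symm.toEmbedding with ht
    have hmem : ∀ p, p ∈ t ↔ finProdFinEquiv p ∈ s := by
      intro p
      rw [ht, Finset.mem_map_equiv, Equiv.symm_symm]
    -- Upper bound: count `t` fibre by fibre over its block indices. At most `lis σ` blocks occur,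
    -- since injectivity of σ excludes ties between distinct blocks, and each fibre has at most `lis
    -- τ` points.
    have hlt : ∀ p ∈ t, ∀ q ∈ t, (p.1 < q.1 ∨ p.1 = q.1 ∧ p.2 < q.2) →
        (σ p.1 < σ q.1 ∨ σ p.1 = σ q.1 ∧ τ p.2 < τ q.2) := by
      intro p hp q hq h
      have := hs ((hmem p).1 hp) ((hmem q).1 hq) ((finProdFinEquiv_lt_iff p q).2 h)
      rwa [kron_finProdFinEquiv, kron_finProdFinEquiv, finProdFinEquiv_lt_iff] at this
    have hcard : s.card = t.card := by simp [ht]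
    have h1 : (t.image Prod.fst).card ≤ lis σ := by
      refine card_le_lis fun i hi i' hi' h => ?_
      simp only [Finset.coe_image, Set.mem_image, Finset.mem_coe] at hi hi'
      obtain ⟨p, hp, rfl⟩ := hi
      obtain ⟨q, hq, rfl⟩ := hi'
      rcases hlt p hp q hq (Or.inl h) with h' | ⟨h', -⟩
      · exact h'
      · exact absurd (σ.injective h') h.ne
    have h2 : ∀ i ∈ t.image Prod.fst, (t.filter fun p => p.1 = i).card ≤ lis τ := by
      intro i _
      have hinj : Set.InjOn Prod.snd ((t.filter fun p => p.1 = i : Finset _) :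
          Set (Fin a × Fin b)) := by
        intro p hp q hq h
        simp only [Finset.coe_filter, Set.mem_ofPred_eq] at hp hq
        exact Prod.ext (hp.2.trans hq.2.symm) h
      rw [← Finset.card_image_of_injOn hinj]
      refine card_le_lis fun j hj j' hj' h => ?_
      simp only [Finset.coe_image, Set.mem_image, Finset.coe_filter, Set.mem_ofPred_eq] at hj hj'
      obtain ⟨p, ⟨hp, hpi⟩, rfl⟩ := hj
      obtain ⟨q, ⟨hq, hqi⟩, rfl⟩ := hj'
      have hpq := hpi.trans hqi.symm
      rcases hlt p hp q hq (Or.inr ⟨hpq, h⟩) with h' | ⟨-, h'⟩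
      · exact absurd h' (by simp [hpq])
      · exact h'
    rw [hcard, Finset.card_eq_sum_card_image Prod.fst t]
    exact (Finset.sum_le_card_nsmul _ _ _ h2).trans (Nat.mul_le_mul_right _ h1)
  -- Lower bound: the product of two optimal sets is increasing.
  · obtain ⟨s, hs, hs'⟩ := exists_card_eq_lis σ
    obtain ⟨t, ht, ht'⟩ := exists_card_eq_lis τ
    rw [← hs', ← ht', ← Finset.card_product, ← Finset.card_map finProdFinEquiv.toEmbedding]
    refine card_le_lis fun x hx y hy h => ?_
    simp only [Finset.coe_map, Set.mem_image, Finset.mem_coe, Finset.mem_product,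
      Equiv.coe_toEmbedding] at hx hy
    obtain ⟨p, hp, rfl⟩ := hx
    obtain ⟨q, hq, rfl⟩ := hy
    rw [kron_finProdFinEquiv, kron_finProdFinEquiv, finProdFinEquiv_lt_iff]
    rcases (finProdFinEquiv_lt_iff p q).1 h with h | ⟨h, h'⟩
    · exact Or.inl (hs hp.1 hq.1 h)
    · exact Or.inr ⟨congrArg σ h, ht hp.2 hq.2 h'⟩

lemma kron_inj (ha : 0 < a) (hb : 0 < b) {σ σ' : Equiv.Perm (Fin a)} {τ τ' : Equiv.Perm (Fin b)}
    (h : kron σ τ = kron σ' τ') : σ = σ' ∧ τ = τ' := by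
  have key : ∀ i j, σ i = σ' i ∧ τ j = τ' j := by
    intro i j
    have := congrArg (fun ρ => ρ (finProdFinEquiv (i, j))) h
    simp only [kron_finProdFinEquiv, EmbeddingLike.apply_eq_iff_eq, Prod.mk.injEq] at this
    exact this
  exact ⟨Equiv.ext fun i => (key i ⟨0, hb⟩).1, Equiv.ext fun j => (key ⟨0, ha⟩ j).2⟩

end Kron

/-! ### Powers of the standard cycle -/

section Rotation

variable {m : ℕ}

lemma finRotate_pow_apply_val (k : ℕ) (i : Fin m) :
    (((finRotate m) ^ k) i : ℕ) = (i + k) % m := by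
  have := i.neZero
  induction k with
  | zero => simp [Nat.mod_eq_of_lt i.2]
  | succ k ih =>
    rw [pow_succ', Equiv.Perm.mul_apply, finRotate_apply, Fin.val_add, ih, Fin.val_one',
      ← Nat.add_mod, add_assoc]

lemma finRotate_pow_injOn : Set.InjOn (fun k => finRotate m ^ k) (Set.Icc 1 m) := by
  rintro k ⟨hk, hk'⟩ l ⟨hl, hl'⟩ h
  have h0 := congrArg (fun ρ => ((ρ ⟨0, by omega⟩ : Fin m) : ℕ)) h
  simp only [finRotate_pow_apply_val, zero_add] at h0
  rcases hk'.lt_or_eq with h1 | rfl <;> rcases hl'.lt_or_eq with h2 | h2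
  · rwa [Nat.mod_eq_of_lt h1, Nat.mod_eq_of_lt h2] at h0
  · subst h2
    rw [Nat.mod_eq_of_lt h1, Nat.mod_self] at h0
    omega
  · rw [Nat.mod_eq_of_lt h2, Nat.mod_self] at h0
    omega
  · exact h2.symm

lemma finRotate_pow_image (hm : 0 < m) :
    (fun k => finRotate m ^ k) '' Set.Icc 1 m = Subgroup.zpowers (finRotate m) := by
  ext ρ
  constructor
  · rintro ⟨k, -, rfl⟩
    exact Subgroup.npow_mem_zpowers _ _
  · intro h
    obtain ⟨k, rfl⟩ := mem_powers_iff_mem_zpowers.2 h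
    -- Exponents range over 1, …, m, so the residue 0 is represented by m.
    refine ⟨if k % m = 0 then m else k % m, ?_, ?_⟩
    · have := Nat.mod_lt k hm
      split_ifs <;> constructor <;> omega
    · ext i
      simp only [finRotate_pow_apply_val]
      split_ifs with h
      · rw [Nat.add_mod_right, Nat.add_mod _ k, h, add_zero, Nat.mod_mod]
      · rw [Nat.add_mod_mod]

lemma lis_finRotate_pow {k : ℕ} (hk : k ∈ Set.Icc 1 m) :
    lis (finRotate m ^ k) = max k (m - k) := by
  classical
  obtain ⟨hk1, hkm⟩ := hk
  have hlow : ∀ i : Fin m, (i : ℕ) < m - k → ((finRotate m ^ k) i : ℕ) = i + k := fun i hi => by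
    rw [finRotate_pow_apply_val, Nat.mod_eq_of_lt (by omega)]
  have hhigh : ∀ i : Fin m, m - k ≤ (i : ℕ) → ((finRotate m ^ k) i : ℕ) = i + k - m :=
    fun i hi => by
      have := i.2
      rw [finRotate_pow_apply_val, Nat.mod_eq_sub_mod (by omega), Nat.mod_eq_of_lt (by omega)]
  have hcard : ∀ p q : ℕ, q ≤ m →
      (Finset.univ.filter fun i : Fin m => p ≤ (i : ℕ) ∧ (i : ℕ) < q).card = q - p := by
    intro p q hq
    rw [← Nat.card_Ico, ← Finset.card_map Fin.valEmbedding]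
    congr 1
    ext x
    simp only [Finset.mem_map, Finset.mem_filter, Finset.mem_univ, true_and, Fin.valEmbedding_apply,
      Finset.mem_Ico]
    exact ⟨by rintro ⟨i, hi, rfl⟩; exact hi, fun hx => ⟨⟨x, by omega⟩, hx, rfl⟩⟩
  refine le_antisymm (lis_le fun s hs => ?_) (max_le ?_ ?_)
  -- Once `s` contains a point of the first run it can contain none of the second, whose positions
  -- are later but whose values are smaller.
  · by_cases h : ∃ i ∈ s, (i : ℕ) < m - k
    · obtain ⟨i, his, hi⟩ := h
      refine le_trans ?_ (le_max_right _ _)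
      calc s.card ≤ _ := Finset.card_le_card (t := Finset.univ.filter
              fun i : Fin m => 0 ≤ (i : ℕ) ∧ (i : ℕ) < m - k) fun j hj => by
            by_contra hj'
            simp only [Finset.mem_filter, Finset.mem_univ, true_and, zero_le, not_lt] at hj'
            have := hs his hj (Fin.lt_def.2 (by omega))
            rw [Fin.lt_def, hlow i hi, hhigh j hj'] at this
            omega
        _ = m - k := by rw [hcard _ _ (by omega), Nat.sub_zero]
    · push Not at h
      refine le_trans ?_ (le_max_left _ _)
      calc s.card ≤ _ := Finset.card_le_card (t := Finset.univ.filter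
              fun i : Fin m => m - k ≤ (i : ℕ) ∧ (i : ℕ) < m) fun j hj => by
            simpa using h j hj
        _ = k := by rw [hcard _ _ le_rfl]; omega
  · calc k = m - (m - k) := by omega
      _ = _ := (hcard (m - k) m le_rfl).symm
      _ ≤ _ := card_le_lis fun i hi j hj h => by
        simp only [Finset.coe_filter, Finset.mem_univ, true_and, Set.mem_ofPred_eq] at hi hj
        rw [Fin.lt_def] at h ⊢
        rw [hhigh i hi.1, hhigh j hj.1]
        omega
  · calc m - k = m - k - 0 := by omega
      _ = _ := (hcard 0 (m - k) (by omega)).symm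
      _ ≤ _ := card_le_lis fun i hi j hj h => by
        simp only [Finset.coe_filter, Finset.mem_univ, true_and, Set.mem_ofPred_eq] at hi hj
        rw [Fin.lt_def] at h ⊢
        rw [hlow i hi.2, hlow j hj.2]
        omega

end Rotation

/-! ### Exponent vectors as coordinates on the butterfly group -/

section Parametrization

/-- The butterfly permutation `τ ^ x₀ ⊗ τ ^ x₁ ⊗ ⋯`, where `τ` is the standard `m`-cycle. -/
def butterfly (m : ℕ) : (n : ℕ) → (Fin n → ℕ) → Equiv.Perm (Fin (m ^ n))
  | 0, _ => 1
  | n + 1, x => (finCongr (pow_succ' m n).symm).permCongr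
      (kron (finRotate m ^ x 0) (butterfly m n (Fin.tail x)))

variable {m : ℕ}

/-- Together with `butterfly_image` this is the bijection that carries uniform exponents to a
uniform permutation. -/
lemma butterfly_injOn (hm : 0 < m) (n : ℕ) :
    Set.InjOn (butterfly m n) (Set.univ.pi fun _ => Set.Icc 1 m) := by
  induction n with
  | zero => exact fun x _ y _ _ => Subsingleton.elim x y
  | succ n ih =>
    intro x hx y hy h
    obtain ⟨h0, h1⟩ := kron_inj hm (pow_pos hm n) (Equiv.injective _ h)
    have h1' : Fin.tail x = Fin.tail y :=
      ih (fun i _ => hx i.succ trivial) (fun i _ => hy i.succ trivial) h1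
    rw [← Fin.cons_self_tail x, ← Fin.cons_self_tail y, h1',
      finRotate_pow_injOn (hx 0 trivial) (hy 0 trivial) h0]

lemma butterfly_image (hm : 0 < m) (n : ℕ) :
    butterfly m n '' (Set.univ.pi fun _ => Set.Icc 1 m) = simpleButterfly m n := by
  induction n with
  | zero =>
    ext ρ
    refine ⟨?_, fun h => ⟨fun _ => 1, fun i => i.elim0, (Subgroup.mem_bot.1 h).symm⟩⟩
    rintro ⟨x, -, rfl⟩
    exact Subgroup.one_mem _
  | succ n ih =>
    ext ρ
    simp only [simpleButterfly, Subgroup.coe_map, Set.mem_image, SetLike.mem_coe,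
      Subgroup.mem_prod, Prod.exists]
    constructor
    · rintro ⟨x, hx, rfl⟩
      refine ⟨_, ⟨finRotate m ^ x 0, butterfly m n (Fin.tail x),
        ⟨Subgroup.npow_mem_zpowers _ _, ?_⟩, rfl⟩, rfl⟩
      rw [← SetLike.mem_coe, ← ih]
      exact Set.mem_image_of_mem _ fun i _ => hx i.succ trivial
    · rintro ⟨_, ⟨α, β, ⟨hα, hβ⟩, rfl⟩, rfl⟩
      rw [← SetLike.mem_coe, ← finRotate_pow_image hm] at hα
      rw [← SetLike.mem_coe, ← ih] at hβ
      obtain ⟨k, hk, rfl⟩ := hα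
      obtain ⟨y, hy, rfl⟩ := hβ
      refine ⟨Fin.cons k y, fun i _ => ?_, rfl⟩
      cases i using Fin.cases with
      | zero => exact hk
      | succ i => exact hy i trivial

lemma lis_butterfly {n : ℕ} {x : Fin n → ℕ} (hx : x ∈ Set.univ.pi fun _ => Set.Icc 1 m) :
    lis (butterfly m n x) = ∏ j, max (x j) (m - x j) := by
  induction n with
  | zero => simpa using lis_of_fin_one _
  | succ n ih =>
    have h : lis (butterfly m n (Fin.tail x)) = _ := ih fun i _ => hx i.succ trivial
    rw [butterfly, lis_permCongr_finCongr, lis_kron, lis_finRotate_pow (hx 0 trivial), h,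
      Fin.prod_univ_succ]
    rfl

end Parametrization

/-! ### Uniform measures and the law of L -/

section Uniform

/-- Counting measure is preserved by an injection, and `f '' s ∩ t` is the image of `s ∩ f ⁻¹' t`.
-/
lemma map_uniformOn_of_injOn {α β : Type*} [MeasurableSpace α] [MeasurableSpace β]
    [DiscreteMeasurableSpace α] [DiscreteMeasurableSpace β] {f : α → β} {s : Set α}
    (hf : Set.InjOn f s) : (uniformOn s).map f = uniformOn (f '' s) := by
  ext t ht
  rw [Measure.map_apply .of_discrete ht, uniformOn, uniformOn, cond_apply .of_discrete,
    cond_apply .of_discrete, ← Set.image_inter_preimage]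
  simp only [Measure.count_apply .of_discrete]
  rw [hf.encard_image, (hf.mono Set.inter_subset_left).encard_image]

lemma count_univ_pi {ι α : Type*} [Fintype ι] [Countable α] [MeasurableSpace α]
    [MeasurableSingletonClass α] {s : ι → Set α} (hs : ∀ i, (s i).Finite) :
    Measure.count (Set.univ.pi s) = ∏ i, Measure.count (s i) := by
  classical
  lift s to ι → Finset α using hs
  rw [← Fintype.coe_piFinset, Measure.count_apply_finset, Fintype.card_piFinset]
  simp

/-- The uniform measure on a product of finite sets is the product of the uniform measures. -/
lemma uniformOn_univ_pi {ι α : Type*} [Fintype ι] [Countable α] [MeasurableSpace α]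
    [MeasurableSingletonClass α] {s : ι → Set α} (hs : ∀ i, (s i).Finite) :
    uniformOn (Set.univ.pi s) = Measure.pi fun i => uniformOn (s i) := by
  refine (Measure.pi_eq fun t ht => ?_).symm
  rw [uniformOn, cond_apply (.univ_pi fun i => (hs i).measurableSet), ← Set.pi_inter_distrib,
    count_univ_pi hs, count_univ_pi fun i => (hs i).inter_of_left _]
  simp only [uniformOn, cond_apply (hs _).measurableSet]
  rw [Finset.prod_mul_distrib, ENNReal.prod_inv_distrib]
  exact fun i _ j _ _ => Or.inr (Measure.count_apply_lt_top.2 (hs j)).ne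

variable {m : ℕ}

lemma isProbabilityMeasure_unifIcc (hm : 0 < m) : IsProbabilityMeasure (unifIcc m) :=
  isProbabilityMeasure_uniformOn (Set.finite_Icc 1 m) ⟨m, hm, le_rfl⟩

/-- Reduces integrals to finite averages and shows that every point of [m] is an atom. -/
lemma unifIcc_eq_sum_dirac (m : ℕ) :
    unifIcc m = ∑ k ∈ Finset.Icc 1 m, (m : ENNReal)⁻¹ • Measure.dirac k := by
  classical
  refine Measure.ext_of_singleton fun k => ?_
  rw [unifIcc, ← Finset.coe_Icc, ← Finset.coe_singleton, uniformOn_apply_finset]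
  simp only [Measure.finsetSum_apply, Measure.smul_apply, smul_eq_mul, Nat.card_Icc,
    Nat.add_sub_cancel, Finset.coe_singleton, Measure.dirac_apply, Set.indicator_apply,
    Set.mem_singleton_iff, Pi.one_apply, mul_ite, mul_one, mul_zero, Finset.sum_ite_eq']
  by_cases h : k ∈ Finset.Icc 1 m
  · simp [h, Finset.inter_singleton_of_mem]
  · simp [h, Finset.inter_singleton_of_notMem]

lemma integrable_unifIcc (m : ℕ) (f : ℕ → ℝ) : Integrable f (unifIcc m) := by
  rcases m.eq_zero_or_pos with rfl | hm
  · simp [unifIcc_eq_sum_dirac]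
  · rw [unifIcc_eq_sum_dirac, integrable_finsetSum_measure]
    exact fun k _ => (integrable_dirac (by simp)).smul_measure (by simp [hm.ne'])

lemma integral_unifIcc (hm : 0 < m) (f : ℕ → ℝ) :
    ∫ x, f x ∂(unifIcc m) = (∑ k ∈ Finset.Icc 1 m, f k) / m := by
  rw [unifIcc_eq_sum_dirac, integral_finsetSum_measure]
  · simp [integral_smul_measure, ← Finset.mul_sum, div_eq_inv_mul]
  · exact fun k _ => (integrable_dirac (by simp)).smul_measure (by simp [hm.ne'])

lemma ae_mem_Icc_pi_unifIcc (m n : ℕ) :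
    ∀ᵐ x ∂(Measure.pi fun _ : Fin n => unifIcc m), x ∈ Set.univ.pi fun _ => Set.Icc 1 m := by
  have hfin : ∀ _ : Fin n, (Set.Icc 1 m).Finite := fun _ => Set.finite_Icc 1 m
  simp only [unifIcc, ← uniformOn_univ_pi hfin]
  exact ae_cond_mem (.univ_pi fun i => (hfin i).measurableSet)

lemma unifSimpleButterfly_eq_map (hm : 0 < m) (n : ℕ) :
    unifSimpleButterfly m n = (Measure.pi fun _ : Fin n => unifIcc m).map (butterfly m n) := by
  simp only [unifSimpleButterfly, unifIcc]
  rw [← uniformOn_univ_pi fun _ : Fin n => Set.finite_Icc 1 m,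
    map_uniformOn_of_injOn (butterfly_injOn hm n), butterfly_image hm n]

lemma map_lis_unifSimpleButterfly (hm : 0 < m) (n : ℕ) :
    (unifSimpleButterfly m n).map lis =
      (Measure.pi fun _ : Fin n => unifIcc m).map fun x => ∏ j, max (x j) (m - x j) := by
  rw [unifSimpleButterfly_eq_map hm, Measure.map_map .of_discrete .of_discrete]
  refine Measure.map_congr ?_
  filter_upwards [ae_mem_Icc_pi_unifIcc m n] with x hx
  exact lis_butterfly hx

variable {Ω Ω' : Type*} [MeasurableSpace Ω] [MeasurableSpace Ω'] {P : Measure Ω} {P' : Measure Ω'}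

/-- The longest increasing subsequence of a uniform simple butterfly permutation is distributed
as a product of independent copies of `max X (m - X)`. -/
lemma identDistrib_lis {n : ℕ} (hm : 0 < m) {σ : Ω → Equiv.Perm (Fin (m ^ n))}
    (hσ : HasLaw σ (unifSimpleButterfly m n) P) {X : Fin n → Ω' → ℕ}
    (hX : HasLaw (fun ω j => X j ω) (Measure.pi fun _ => unifIcc m) P') :
    IdentDistrib (fun ω => lis (σ ω)) (fun ω => ∏ j, max (X j ω) (m - X j ω)) P P' := by
  have h1 : HasLaw (lis : Equiv.Perm (Fin (m ^ n)) → ℕ) ((unifSimpleButterfly m n).map lis)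
      (unifSimpleButterfly m n) := ⟨Measurable.of_discrete.aemeasurable, rfl⟩
  have h2 : HasLaw (fun x : Fin n → ℕ => ∏ j, max (x j) (m - x j))
      ((unifSimpleButterfly m n).map lis) (Measure.pi fun _ => unifIcc m) :=
    ⟨Measurable.of_discrete.aemeasurable, (map_lis_unifSimpleButterfly hm n).symm⟩
  have h3 := h1.fun_comp hσ
  have h4 := h2.fun_comp hX
  exact ⟨h3.aemeasurable, h4.aemeasurable, h3.map_eq.trans h4.map_eq.symm⟩

end Uniform

/-! ### The mean of L -/

section Expectation

variable {m : ℕ}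

lemma integral_max_pos (hm : 0 < m) :
    0 < ∫ x, ((max x (m - x) : ℕ) : ℝ) ∂(unifIcc m) := by
  rw [integral_unifIcc hm fun x => ((max x (m - x) : ℕ) : ℝ)]
  refine div_pos (Finset.sum_pos (fun k hk => ?_) ⟨m, Finset.mem_Icc.2 ⟨hm, le_rfl⟩⟩) (by exact_mod_cast hm)
  have := (Finset.mem_Icc.1 hk).1
  exact_mod_cast lt_max_of_lt_left this

lemma integrable_and_integral_lis {n : ℕ} (hm : 2 ≤ m) {Ω : Type*} [MeasurableSpace Ω]
    {P : Measure Ω} {σ : Ω → Equiv.Perm (Fin (m ^ n))}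
    (hσ : HasLaw σ (unifSimpleButterfly m n) P) :
    Integrable (fun ω => (lis (σ ω) : ℝ)) P ∧
      ∫ ω, (lis (σ ω) : ℝ) ∂P = ((m ^ n : ℕ) : ℝ) ^ alphaConst m := by
  have hm0 : 0 < m := by omega
  have := isProbabilityMeasure_unifIcc hm0
  -- The product space itself, with its coordinates, serves as a model of the i.i.d. sample.
  have h := (identDistrib_lis hm0 hσ (X := fun j x => x j)
    (P' := Measure.pi fun _ : Fin n => unifIcc m) HasLaw.id).comp
    (u := fun k : ℕ => (k : ℝ)) .of_discrete
  have hprod : ((fun k : ℕ => (k : ℝ)) ∘ fun x : Fin n → ℕ => ∏ j, max (x j) (m - x j)) =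
      fun x => ∏ j, ((max (x j) (m - x j) : ℕ) : ℝ) := by
    ext x
    simp only [Function.comp_apply, Nat.cast_prod]
  rw [hprod] at h
  refine ⟨h.integrable_iff.2 ?_, h.integral_eq.trans ?_⟩
  · exact Integrable.fintype_prod
      (f := fun _ x => ((max x (m - x) : ℕ) : ℝ)) fun _ => integrable_unifIcc m _
  · have hm1 : (1 : ℝ) < m := by exact_mod_cast hm
    -- The integral factors into n equal means, and `(m ^ n) ^ α = (m ^ α) ^ n`; positivity of the
    -- mean is what identifies `m ^ α` with it.
    rw [integral_fintype_prod_eq_prod (f := fun _ x => ((max x (m - x) : ℕ) : ℝ)),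
      Finset.prod_const, Finset.card_univ, Fintype.card_fin, Nat.cast_pow,
      ← Real.rpow_natCast (m : ℝ), ← Real.rpow_mul (by positivity), mul_comm,
      Real.rpow_mul (by positivity), alphaConst,
      Real.rpow_logb (by positivity) hm1.ne' (integral_max_pos hm0), Real.rpow_natCast]

end Expectation

/-! ### The central limit theorem for log L -/

section CentralLimit

variable {m : ℕ}

/-- Zero variance would make the logarithm constant on the atoms 1, …, m, yet X = 1 gives m - 1 and
X = m gives m. -/
lemma nuConst_pos (hm : 2 ≤ m) : 0 < nuConst m := by
  have hm0 : 0 < m := by omega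
  have := isProbabilityMeasure_unifIcc hm0
  refine (variance_nonneg _ _).lt_of_ne' fun h => ?_
  have hae := ae_eq_integral_of_variance_eq_zero ((memLp_two_iff_integrable_sq
    Measurable.of_discrete.aestronglyMeasurable).2 (integrable_unifIcc m _)) h
  have hk : ∀ k ∈ Finset.Icc 1 m, Real.logb m ((max k (m - k) : ℕ) : ℝ) = muConst m := by
    intro k hk
    by_contra hne
    have h0 := measure_mono_null (Set.singleton_subset_iff.2 hne) hae
    rw [unifIcc_eq_sum_dirac, Measure.finsetSum_apply, Finset.sum_eq_zero_iff] at h0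
    simpa using h0 k hk
  have h1 := (hk 1 (by simp; omega)).trans (hk m (by simp; omega)).symm
  have e1 : max 1 (m - 1) = m - 1 := by omega
  have e2 : max m (m - m) = m := by omega
  rw [e1, e2] at h1
  have h2 := Real.logb_injOn_pos (b := m) (by exact_mod_cast hm)
    (show ((m - 1 : ℕ) : ℝ) ∈ Set.Ioi 0 from by simp; omega)
    (show ((m : ℕ) : ℝ) ∈ Set.Ioi 0 from by simp; omega) h1
  have h3 : m - 1 = m := by exact_mod_cast h2
  omega

lemma tendstoInDistribution_logb_lis (hm : 2 ≤ m)
    {Ω : ℕ → Type*} [∀ n, MeasurableSpace (Ω n)]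
    (P : ∀ n, Measure (Ω n)) [∀ n, IsProbabilityMeasure (P n)]
    {σ : ∀ n, Ω n → Equiv.Perm (Fin (m ^ n))}
    (hσ : ∀ n, HasLaw (σ n) (unifSimpleButterfly m n) (P n))
    {Ω' : Type*} [MeasurableSpace Ω'] {P' : Measure Ω'} [IsProbabilityMeasure P'] {Z : Ω' → ℝ}
    (hZ : HasLaw Z (gaussianReal 0 1) P') :
    TendstoInDistribution
      (fun (n : ℕ) ω => (Real.logb m (lis (σ n ω)) - muConst m * n) / √(nuConst m * n))
      atTop Z P P' := by
  have hm0 : 0 < m := by omega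
  have := isProbabilityMeasure_unifIcc hm0
  have hν := nuConst_pos hm
  set g : ℕ → ℝ := fun x => Real.logb m ((max x (m - x) : ℕ) : ℝ) with hg
  set Y : ℕ → ℝ := fun x => (g x - muConst m) / √(nuConst m) with hY
  -- One infinite product space carries all the exponents, as the central limit theorem needs a
  -- single i.i.d. sequence.
  set Q : Measure (ℕ → ℕ) := Measure.infinitePi fun _ => unifIcc m with hQ
  have hlaw : ∀ k, HasLaw (fun ω : ℕ → ℕ => ω k) (unifIcc m) Q := fun k =>
    (measurePreserving_eval_infinitePi (fun _ : ℕ => unifIcc m) k).hasLaw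
  have hYm : Measurable Y := .of_discrete
  have hlawY : ∀ k, HasLaw (fun ω : ℕ → ℕ => Y (ω k)) ((unifIcc m).map Y) Q := fun k =>
    HasLaw.fun_comp ⟨hYm.aemeasurable, rfl⟩ (hlaw k)
  have hindep : iIndepFun (fun (k : ℕ) (ω : ℕ → ℕ) => ω k) Q :=
    iIndepFun_infinitePi (X := fun _ x => x) fun _ => measurable_id
  have hint : ∫ x, g x ∂(unifIcc m) = muConst m := rfl
  have hvar : variance g (unifIcc m) = nuConst m := rfl
  have clt := tendstoInDistribution_inv_sqrt_mul_sum (P := Q) (X := fun k ω => Y (ω k)) hZ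
    (by
      rw [← Function.comp_def, (hlaw 0).integral_comp hYm.aestronglyMeasurable]
      simp only [hY]
      rw [integral_div, integral_sub (integrable_unifIcc m _) (by simp), hint]
      simp)
    (by
      have h := (hlaw 0).integral_comp (f := fun x => Y x ^ 2)
        Measurable.of_discrete.aestronglyMeasurable
      refine h.trans ?_
      simp only [hY, div_pow]
      rw [integral_div, Real.sq_sqrt hν.le, ← hint,
        ← variance_eq_integral Measurable.of_discrete.aemeasurable, hvar, div_self hν.ne'])
    (hindep.comp (fun _ => Y) fun _ => hYm)
    (fun k => ⟨(hlawY k).aemeasurable, (hlawY 0).aemeasurable,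
      (hlawY k).map_eq.trans (hlawY 0).map_eq.symm⟩)
  -- The `σ n` may live on unrelated spaces, but convergence in distribution sees only their laws.
  -- At n = 0 both sides vanish.
  have key : ∀ n : ℕ, IdentDistrib
      (fun ω => (Real.logb m (lis (σ n ω)) - muConst m * n) / √(nuConst m * n))
      (fun ω : ℕ → ℕ => (√n)⁻¹ * ∑ k ∈ Finset.range n, Y (ω k)) (P n) Q := by
    intro n
    have hvec : HasLaw (fun (ω : ℕ → ℕ) (j : Fin n) => ω j) (Measure.pi fun _ => unifIcc m) Q :=
      (hindep.precomp Fin.val_injective).hasLaw_pi fun j => hlaw j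
    have h := (identDistrib_lis hm0 (hσ n) hvec).comp (u := fun k : ℕ =>
      (Real.logb m k - muConst m * n) / √(nuConst m * n)) .of_discrete
    refine ⟨h.aemeasurable_fst, ?_, h.map_eq.trans (Measure.map_congr ?_)⟩
    · exact (Finset.aemeasurable_fun_sum _ fun k _ => (hlawY k).aemeasurable).const_mul _
    · have hpos : ∀ᵐ ω ∂Q, ∀ j : Fin n, ω j ∈ Set.Icc 1 m := by
        filter_upwards [ae_of_ae_map hvec.aemeasurable
          (hvec.map_eq ▸ ae_mem_Icc_pi_unifIcc m n)] with ω hω j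
        exact hω j trivial
      filter_upwards [hpos] with ω hω
      have hlog : Real.logb m ((∏ j : Fin n, max (ω j) (m - ω j) : ℕ) : ℝ) =
          ∑ k ∈ Finset.range n, g (ω k) := by
        rw [Nat.cast_prod, Real.logb_prod, ← Fin.sum_univ_eq_sum_range fun k => g (ω k)]
        intro j _
        have := (hω j).1
        exact_mod_cast (lt_max_of_lt_left this).ne'
      simp only [Function.comp_apply, hlog, hY]
      rw [← Finset.sum_div, Finset.sum_sub_distrib, Finset.sum_const, Finset.card_range,
        nsmul_eq_mul, Real.sqrt_mul hν.le, mul_comm (n : ℝ), ← div_div,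
        div_eq_inv_mul _ √(n : ℝ)]
  refine ⟨fun n => (key n).aemeasurable_fst, hZ.aemeasurable, ?_⟩
  refine clt.tendsto.congr fun n => ?_
  exact Subtype.ext (key n).map_eq.symm

end CentralLimit

/-! ### The binary case -/

section Binary

lemma Icc_one_two : Finset.Icc 1 2 = ({1, 2} : Finset ℕ) := rfl

lemma unifIcc_two :
    unifIcc 2 = (2 : ENNReal)⁻¹ • Measure.dirac 1 + (2 : ENNReal)⁻¹ • Measure.dirac 2 := by
  rw [unifIcc_eq_sum_dirac]
  simp [Icc_one_two]

lemma muConst_two : muConst 2 = 1 / 2 := by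
  rw [muConst, integral_unifIcc two_pos fun x => Real.logb (2 : ℕ) ((max x (2 - x) : ℕ) : ℝ)]
  norm_num [Icc_one_two]

lemma nuConst_two : nuConst 2 = 1 / 4 := by
  have hmu := muConst_two
  rw [muConst] at hmu
  rw [nuConst, variance_eq_integral Measurable.of_discrete.aemeasurable, hmu,
    integral_unifIcc two_pos fun x => (Real.logb (2 : ℕ) ((max x (2 - x) : ℕ) : ℝ) - 1 / 2) ^ 2]
  norm_num [Icc_one_two]

lemma hasLaw_logb_lis_two {n : ℕ} {Ω : Type*} [MeasurableSpace Ω] {P : Measure Ω}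
    {σ : Ω → Equiv.Perm (Fin (2 ^ n))} (hσ : HasLaw σ (unifSimpleButterfly 2 n) P) :
    HasLaw (fun ω => Real.logb 2 (lis (σ ω)))
      ((binomial n ⟨1 / 2, by norm_num, by norm_num⟩).map (Nat.cast : ℕ → ℝ)) P := by
  classical
  set p : unitInterval := ⟨1 / 2, by norm_num, by norm_num⟩ with hp
  -- These are the coordinate laws behind `setBernoulli`, through which `binomial` is defined: fair
  -- coins below n, constantly false from n on.
  set B : ℕ → Measure Prop := fun i => unitInterval.toNNReal p • Measure.dirac (i ∈ Set.Iio n) +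
    unitInterval.toNNReal (unitInterval.symm p) • Measure.dirac False with hB
  set Q : Measure (ℕ → Prop) := Measure.infinitePi B with hQ
  -- Heads becomes X = 2, with factor max(2, 0) = 2; tails becomes X = 1, with factor max(1, 1) = 1.
  set φ : Prop → ℕ := fun q => if q then 2 else 1 with hφ
  have hlaw : ∀ j : Fin n, HasLaw (fun ω : ℕ → Prop => φ (ω j)) (unifIcc 2) Q := by
    intro j
    refine HasLaw.fun_comp (Y := φ) (μ := B j) ⟨Measurable.of_discrete.aemeasurable, ?_⟩
      (measurePreserving_eval_infinitePi B j).hasLaw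
    have h1 : unitInterval.toNNReal p = 2⁻¹ := by
      ext; simp [hp]
    have h2 : unitInterval.toNNReal (unitInterval.symm p) = 2⁻¹ := by
      ext; simp [hp]; norm_num
    rw [unifIcc_two, hB]
    simp only [h1, h2]
    rw [Measure.map_add _ _ .of_discrete, Measure.map_smul, Measure.map_smul,
      Measure.map_dirac' .of_discrete, Measure.map_dirac' .of_discrete, add_comm]
    simp [hφ, ENNReal.smul_def]
  have hindep : iIndepFun (fun (j : Fin n) (ω : ℕ → Prop) => φ (ω j)) Q :=
    (iIndepFun_infinitePi (P := B) (X := fun _ => φ) fun _ => .of_discrete).precomp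
      Fin.val_injective
  have h := (identDistrib_lis two_pos hσ (hindep.hasLaw_pi hlaw)).comp
    (u := fun k : ℕ => Real.logb 2 k) .of_discrete
  refine ⟨h.aemeasurable_fst, h.map_eq.trans ?_⟩
  have hmeas : Measurable fun (ω : ℕ → Prop) => {i | ω i} :=
    MeasurableEquiv.setOfPred.measurable
  rw [binomial, Measure.map_map .of_discrete (by fun_prop), setBernoulli_eq_map]
  -- Almost surely no heads occur from index n on, so the random set is counted by the first n
  -- coordinates.
  have hae : ∀ᵐ ω ∂Q, {i | ω i} ⊆ Set.Iio n := by
    refine ae_of_ae_map (p := fun s => s ⊆ Set.Iio n) hmeas.aemeasurable ?_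
    rw [hQ, hB, ← setBernoulli_eq_map]
    exact setBernoulli_ae_subset
  rw [Measure.map_map (by fun_prop) hmeas]
  refine Measure.map_congr ?_
  filter_upwards [hae] with ω hω
  have hmax : ∀ q : Prop, max (φ q) (2 - φ q) = 2 ^ (if q then 1 else 0) := by
    intro q
    by_cases hq : q <;> simp [hφ, hq]
  have hset : {i | ω i} = ((Finset.univ.filter fun j : Fin n => ω j).map Fin.valEmbedding :
      Finset ℕ) := by
    ext i
    simp only [Finset.coe_map, Set.mem_image, Finset.coe_filter, Finset.mem_univ, true_and,
      Fin.valEmbedding_apply]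
    exact ⟨fun hi => ⟨⟨i, hω hi⟩, hi, rfl⟩, by rintro ⟨j, hj, rfl⟩; exact hj⟩
  simp only [Function.comp_apply, hmax, hset, Set.ncard_coe_finset, Finset.card_map]
  rw [Finset.prod_pow_eq_pow_sum, ← Finset.card_filter, Nat.cast_pow, Nat.cast_ofNat,
    Real.logb_pow, Real.logb_self_eq_one one_lt_two, mul_one]

end Binary

end Butterfly

theorem theoremt (m : ℕ) (hm : 2 ≤ m)
    {Ω : ℕ → Type*} [∀ n, MeasurableSpace (Ω n)]
    (P : ∀ n, Measure (Ω n)) [∀ n, IsProbabilityMeasure (P n)]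
    (σ : ∀ n, Ω n → Equiv.Perm (Fin (m ^ n)))
    (hσ : ∀ n, HasLaw (σ n) (Butterfly.unifSimpleButterfly m n) (P n))
    {Ω' : Type*} [MeasurableSpace Ω'] (P' : Measure Ω') [IsProbabilityMeasure P'] :
    -- the law of the longest increasing subsequence
    (∀ (n : ℕ) (X : Fin n → Ω' → ℕ), iIndepFun X P' →
      (∀ j, HasLaw (X j) (Butterfly.unifIcc m) P') →
      IdentDistrib (fun ω => Butterfly.lis (σ n ω))
        (fun ω => ∏ j, max (X j ω) (m - X j ω)) (P n) P') ∧
    -- its expectation is `N ^ α_m` with `N = m ^ n`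
    (∀ n : ℕ, Integrable (fun ω => (Butterfly.lis (σ n ω) : ℝ)) (P n) ∧
      ∫ ω, (Butterfly.lis (σ n ω) : ℝ) ∂(P n) = ((m ^ n : ℕ) : ℝ) ^ Butterfly.alphaConst m) ∧
    -- the central limit theorem
    (∀ Z : Ω' → ℝ, HasLaw Z (gaussianReal 0 1) P' →
      TendstoInDistribution
        (fun (n : ℕ) ω => (Real.logb m (Butterfly.lis (σ n ω)) - Butterfly.muConst m * n) /
          √(Butterfly.nuConst m * n))
        atTop Z P P') ∧
    -- the binary case
    (m = 2 →
      (∀ n : ℕ, HasLaw (fun ω => Real.logb 2 (Butterfly.lis (σ n ω)))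
        ((binomial n ⟨1 / 2, by norm_num, by norm_num⟩).map (Nat.cast : ℕ → ℝ)) (P n)) ∧
      (∀ Z : Ω' → ℝ, HasLaw Z (gaussianReal 0 1) P' →
        TendstoInDistribution
          (fun (n : ℕ) ω => (Real.logb 2 (Butterfly.lis (σ n ω)) - n / 2) * 2 / √n)
          atTop Z P P')) := by
  have hm0 : 0 < m := by omega
  refine ⟨fun n X hX hlaw => Butterfly.identDistrib_lis hm0 (hσ n) (hX.hasLaw_pi hlaw),
    fun n => Butterfly.integrable_and_integral_lis hm (hσ n),
    fun Z hZ => Butterfly.tendstoInDistribution_logb_lis hm P hσ hZ, ?_⟩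
  rintro rfl
  refine ⟨fun n => Butterfly.hasLaw_logb_lis_two (hσ n), fun Z hZ => ?_⟩
  -- With mean 1/2 and variance 1/4, the general normalization becomes the stated one pointwise.
  refine (Butterfly.tendstoInDistribution_logb_lis hm P hσ hZ).congr (fun n => ?_) .rfl
  refine .of_forall fun ω => ?_
  have h4 : √(1 / 4 : ℝ) = 1 / 2 := by
    rw [show (1 / 4 : ℝ) = (1 / 2) ^ 2 by norm_num, Real.sqrt_sq (by norm_num)]
  simp only [Butterfly.muConst_two, Butterfly.nuConst_two]
  rw [Real.sqrt_mul (by norm_num), h4, Nat.cast_ofNat, ← div_div]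
  ring
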